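/- Let $p\ge 3$ be a prime, let $k$ be a positive integer with $p\nmid k$, and put $\phi(x)=x^p+kpx^{p-1}-kp\in\mathbb{Z}[x]$. Let $a=-(p-1)k$, which is the nonzero critical point of $\phi$. Write $\phi^n$ for the $n$-th iterate of $\phi$ under composition (with $\phi^0(x)=x$), and let $K_n$ be the splitting field of $\phi^n$ over $\mathbb{Q}$ inside a fixed algebraic closure of $\mathbb{Q}$ (so $K_0=\mathbb{Q}$). Fix $n\ge 1$. If $\phi^n(a)\ne ky^2$ for every $y\in\mathbb{Z}$, then $\mathrm{Gal}(K_n/K_{n-1})$ is maximal, i.e. equal to $S_p^{p^{n-1}}$: the polynomial $\phi^{n-1}$ has exactly $m=p^{n-1}$ distinct roots $\alpha_1,\dots,\alpha_m$, each equation $\phi(x)=\alpha_i$ has exactly $p$ distinct solutions, all of them in $K_n$, and the action of $\mathrm{Gal}(K_n/K_{n-1})$ on these $m$ sets of solutions is an isomorphism of $\mathrm{Gal}(K_n/K_{n-1})$ onto the product of their $m$ symmetric groups. -/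

import Mathlib

open Polynomial

namespace Arboreal

/-- The `n`-th iterate `φ^n` of a polynomial under composition, with `φ^0 = X`. -/
noncomputable def iter {R : Type*} [CommRing R] (φ : R[X]) (n : ℕ) : R[X] :=
  φ.comp^[n] X

/-- `K_n`: the splitting field over `K` of the iterate `φ^n`, inside a fixed algebraic closure
of `K`. Since `φ^0 = X`, the field `K_0` is `K`. -/
noncomputable def splitField {K : Type*} [Field K] (φ : K[X]) (n : ℕ) :
    IntermediateField K (AlgebraicClosure K) :=
  IntermediateField.adjoin K ((iter φ n).rootSet (AlgebraicClosure K))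

/-- `Gal(K_n / K_{n-1})` is maximal (for `n ≥ 1`): it is the group `S_d ^ m`, where `d = deg φ` and
`m = deg φ^(n-1)`. In detail: `K_{n-1} ⊆ K_n`; the roots of `φ^(n-1)` can be listed
as `α_1, …, α_m` and, for each `i`, the solutions of `φ(x) = α_i` as `β_{i,1}, …, β_{i,d}`
(all distinct and in `K_n`), and there is a group isomorphism `e` from `Gal(K_n / K_{n-1})`
onto `S_d ^ m` such that `σ β_{i,j} = β_{i, e(σ)_i(j)}`. -/
def GalIsMaximal {K : Type*} [Field K] (φ : K[X]) (n : ℕ) : Prop :=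
  ∃ (h : splitField φ (n - 1) ≤ splitField φ n)
    (α : Fin (iter φ (n - 1)).natDegree ≃ (iter φ (n - 1)).rootSet (AlgebraicClosure K))
    (β : (i : Fin (iter φ (n - 1)).natDegree) → (Fin φ.natDegree ≃
      {x : IntermediateField.extendScalars h //
        aeval (x : AlgebraicClosure K) φ = (α i : AlgebraicClosure K)}))
    (e : (IntermediateField.extendScalars h ≃ₐ[splitField φ (n - 1)]
        IntermediateField.extendScalars h) ≃*
      (Fin (iter φ (n - 1)).natDegree → Equiv.Perm (Fin φ.natDegree))),
    ∀ σ i j, σ (β i j).1 = (β i (e σ i j)).1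

/-- The trinomial `x^p + k p x^(p-1) - k p`. -/
noncomputable def phi (p : ℕ) (k : ℤ) : ℤ[X] :=
  X ^ p + C (k * p) * X ^ (p - 1) - C (k * p)

/-- The nonzero critical point `a = -(p-1)k` of `phi p k`. -/
def critPt (p : ℕ) (k : ℤ) : ℤ := -((p : ℤ) - 1) * k

end Arboreal

/-! The proof produces one transposition from ramification and spreads it by group theory.

Since `φ(x) = x^(p-1)(x + kp) - kp`, the point `-kp` is fixed and `φ^m(0) = -kp` for all `m ≥ 1`.
Also `φ ≡ x^p` mod `p`, so every iterate is Eisenstein at `p`, hence irreducible. Write `φ^n(a) =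
kc`. Then `c > 0`, `c ≡ 1` mod `p` and `c ≡ -p` mod `k`. By hypothesis `c` is not a square, so some
prime `l` divides it to an odd power, and the congruences give `l ∤ kp`
(`exists_prime_iter_phi_critPt`).

Modulo `l`, the orbit of `0` stays at `-kp ≠ 0`, so the only multiple root of `φ^n` is `a`, and it
is double. Were the inertia at a prime above `l` trivial, the two roots reducing to `a` would be
equally close to `a` and `φ^n(a)` would have even valuation. So inertia is nontrivial, and it can
only exchange these two roots (`exists_algEquiv_swap_roots`).

The Galois group is transitive on the roots of `φ^n` and preserves the fibres of `φ`, which have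
prime size `p`; one transposition therefore forces all transpositions inside fibres
(`swap_mem_of_fiber_card_prime`). These fix the roots of `φ^(n-1)` and generate the product of
symmetric groups (`galIsMaximal_of_forall_swap`). -/

namespace Arboreal

/-! ### Iterates of a polynomial. -/

section Iterates

variable {R : Type*} [CommRing R]

@[simp] theorem iter_zero (φ : R[X]) : iter φ 0 = X := rfl

theorem iter_succ (φ : R[X]) (n : ℕ) : iter φ (n + 1) = φ.comp (iter φ n) :=
  Function.iterate_succ_apply' _ _ _

theorem iter_succ_comp (φ : R[X]) (n : ℕ) : iter φ (n + 1) = (iter φ n).comp φ := by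
  induction n with
  | zero => simp [iter_succ]
  | succ n ih => rw [iter_succ, ih, ← comp_assoc, ← iter_succ, ih]

theorem iter_add (φ : R[X]) (m n : ℕ) : iter φ (m + n) = (iter φ m).comp (iter φ n) := by
  induction m with
  | zero => simp
  | succ m ih => rw [Nat.add_right_comm, iter_succ, ih, iter_succ, comp_assoc]

theorem iter_map {S : Type*} [CommRing S] (g : R →+* S) (φ : R[X]) (n : ℕ) :
    (iter φ n).map g = iter (φ.map g) n := by
  induction n with
  | zero => simp
  | succ n ih => rw [iter_succ, iter_succ, map_comp, ih]

theorem iter_eval_succ (φ : R[X]) (n : ℕ) (x : R) :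
    (iter φ (n + 1)).eval x = φ.eval ((iter φ n).eval x) := by
  rw [iter_succ, eval_comp]

theorem iter_eval_add (φ : R[X]) (m n : ℕ) (x : R) :
    (iter φ (m + n)).eval x = (iter φ m).eval ((iter φ n).eval x) := by
  rw [iter_add, eval_comp]

theorem natDegree_iter [IsDomain R] (φ : R[X]) (n : ℕ) :
    (iter φ n).natDegree = φ.natDegree ^ n := by
  induction n with
  | zero => simp
  | succ n ih => rw [iter_succ, natDegree_comp, ih, pow_succ']

theorem monic_iter [IsDomain R] {φ : R[X]} (hφ : φ.Monic) (h0 : φ.natDegree ≠ 0) (n : ℕ) :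
    (iter φ n).Monic := by
  induction n with
  | zero => simp
  | succ n ih =>
    rw [iter_succ]
    refine hφ.comp ih ?_
    rw [natDegree_iter]
    exact pow_ne_zero _ h0

theorem derivative_iter_eval (φ : R[X]) (n : ℕ) (x : R) :
    (derivative (iter φ n)).eval x =
      ∏ j ∈ Finset.range n, (derivative φ).eval ((iter φ j).eval x) := by
  induction n with
  | zero => simp
  | succ n ih =>
    rw [iter_succ, derivative_comp, eval_mul, ih, eval_comp, Finset.prod_range_succ, mul_comm]

theorem iter_X_pow (d n : ℕ) : iter (X ^ d : R[X]) n = X ^ d ^ n := by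
  induction n with
  | zero => simp
  | succ n ih => rw [iter_succ, ih, X_pow_comp, ← pow_mul, pow_succ]

end Iterates

/-! ### Arithmetic of the trinomial: critical orbit and irreducibility. -/

section Phi

variable {p : ℕ} (k : ℤ)

theorem phi_eval (x : ℤ) : (phi p k).eval x = x ^ p + k * p * x ^ (p - 1) - k * p := by
  simp [phi]

theorem natDegree_phi (hp3 : 3 ≤ p) : (phi p k).natDegree = p := by
  unfold phi
  compute_degree!
  omega

theorem monic_phi (hp3 : 3 ≤ p) : (phi p k).Monic := by
  have h : (C (k * p) * X ^ (p - 1) - C (k * p) : ℤ[X]).degree < p := by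
    refine lt_of_le_of_lt (b := ((p - 1 : ℕ) : WithBot ℕ)) ?_ (by exact_mod_cast (by omega))
    compute_degree!
  rw [phi, add_sub_assoc]
  exact monic_X_pow_add h

/-- `0` maps to `-kp`, which is fixed because `x^p + kp x^(p-1) = x^(p-1)(x + kp)` vanishes there.
-/
theorem iter_phi_eval_zero (hp : p.Prime) (hp3 : 3 ≤ p) (n : ℕ) :
    (iter (phi p k) (n + 1)).eval 0 = -(k * p) := by
  induction n with
  | zero =>
    rw [iter_eval_succ, phi_eval]
    simp [hp.ne_zero, show p - 1 ≠ 0 by omega]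
  | succ n ih =>
    rw [iter_eval_succ, ih, phi_eval]
    have hodd : Odd p := hp.odd_of_ne_two (by omega)
    obtain ⟨q, rfl⟩ : ∃ q, p = q + 1 := ⟨p - 1, by omega⟩
    rw [Nat.add_sub_cancel, pow_succ]
    ring

theorem derivative_phi (hp3 : 3 ≤ p) :
    derivative (phi p k) = C (p : ℤ) * X ^ (p - 2) * (X - C (critPt p k)) := by
  obtain ⟨q, rfl⟩ : ∃ q, p = q + 2 := ⟨p - 2, by omega⟩
  have h : q + 2 - 1 = q + 1 := by omega
  simp only [phi, critPt, h, Nat.add_sub_cancel, derivative_sub, derivative_add, derivative_C,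
    derivative_mul, derivative_X_pow]
  push_cast
  simp only [map_mul, map_add, map_neg, map_sub, map_natCast, map_ofNat, map_one]
  ring

theorem iter_phi_eval_critPt_succ (hp3 : 3 ≤ p) {c : ℤ} {n : ℕ}
    (h : (iter (phi p k) n).eval (critPt p k) = k * c) :
    (iter (phi p k) (n + 1)).eval (critPt p k) =
      k * (k ^ (p - 1) * c ^ (p - 1) * (c + p) - p) := by
  obtain ⟨q, rfl⟩ : ∃ q, p = q + 1 := ⟨p - 1, by omega⟩
  rw [iter_eval_succ, h, phi_eval, Nat.add_sub_cancel]
  ring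

/-- Along the critical orbit, `c` follows the recursion `c ↦ k^(p-1) c^(p-1) (c + p) - p`. Fermat
preserves `c ≡ 1` mod `p`, and the factor `k^(p-1)` gives the congruence mod `k`. Positivity lets
non-squareness be read off prime exponents. -/
theorem exists_iter_phi_eval_critPt (hp : p.Prime) (hp3 : 3 ≤ p) (hk : 0 < k)
    (hpk : ¬ (p : ℤ) ∣ k) (n : ℕ) : ∃ c : ℤ, 0 < c ∧ (p : ℤ) ∣ c - 1 ∧ k ∣ c + p ∧
      (iter (phi p k) (n + 1)).eval (critPt p k) = k * c := by
  have : Fact p.Prime := ⟨hp⟩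
  have hfermat : ∀ x : ℤ, (p : ℤ) ∣ x - 1 →
      (p : ℤ) ∣ (k ^ (p - 1) * x ^ (p - 1) * (x + p) - p) - 1 := by
    intro x hx
    rw [← ZMod.intCast_zmod_eq_zero_iff_dvd] at hx hpk ⊢
    push_cast at hx ⊢
    have hx1 : (x : ZMod p) = 1 := sub_eq_zero.1 hx
    rw [ZMod.pow_card_sub_one_eq_one hpk, hx1]
    simp
  have hkdvd : ∀ x : ℤ, k ∣ (k ^ (p - 1) * x ^ (p - 1) * (x + p) - p) + p := by
    intro x
    rw [sub_add_cancel, mul_assoc]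
    exact Dvd.dvd.mul_right (dvd_pow_self k (by omega)) _
  have hk1 : 1 ≤ k ^ (p - 1) := one_le_pow₀ hk
  have hp3' : (3 : ℤ) ≤ p := by exact_mod_cast hp3
  induction n with
  | zero =>
    -- The orbit starts at `a = k(1 - p)`. Here `1 - p` is negative, but `p - 1` is even, so the
    -- next value is positive.
    refine ⟨_, ?_, hfermat (1 - p) ⟨-1, by ring⟩, hkdvd _,
      iter_phi_eval_critPt_succ k hp3 (n := 0) (c := 1 - p) (by simp [critPt]; ring)⟩
    have heven : Even (p - 1) := hp.even_sub_one (by omega)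
    rw [sub_add_cancel, mul_one, ← heven.neg_pow (1 - (p : ℤ)), neg_sub]
    have h2 : ((p : ℤ) - 1) ^ 2 ≤ ((p : ℤ) - 1) ^ (p - 1) :=
      pow_le_pow_right₀ (by omega) (by omega)
    nlinarith
  | succ n ih =>
    obtain ⟨c, hc, hcp, -, hce⟩ := ih
    refine ⟨_, ?_, hfermat c hcp, hkdvd _, iter_phi_eval_critPt_succ k hp3 hce⟩
    have h1 : 1 ≤ c ^ (p - 1) := one_le_pow₀ hc
    have h2 : 1 ≤ k ^ (p - 1) * c ^ (p - 1) := one_le_mul_of_one_le_of_one_le hk1 h1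
    nlinarith

/-- A positive integer that is not a square is divisible by some prime to an odd power. -/
theorem exists_prime_odd_pow {c : ℕ} (hc : 0 < c) (hsq : ¬ IsSquare c) :
    ∃ l r u : ℕ, l.Prime ∧ ¬ l ∣ u ∧ c = l ^ (2 * r + 1) * u := by
  obtain ⟨s, b, hbs, hs⟩ := Nat.sq_mul_squarefree c
  have hs1 : s ≠ 1 := by
    rintro rfl
    exact hsq ⟨b, by rw [← hbs]; ring⟩
  obtain ⟨l, hl, t, rfl⟩ := Nat.exists_prime_and_dvd hs1
  have hb : b ≠ 0 := by
    rintro rfl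
    simp at hbs; omega
  obtain ⟨r, b', hb', rfl⟩ := Nat.exists_eq_pow_mul_and_not_dvd hb l hl.ne_one
  refine ⟨l, r, b' ^ 2 * t, hl, fun h => ?_, by rw [← hbs]; ring⟩
  rcases hl.dvd_mul.1 h with h | ⟨t', rfl⟩
  · exact hb' (hl.dvd_of_dvd_pow h)
  · exact hl.ne_one (Nat.isUnit_iff.1 (hs l ⟨t', by ring⟩))

theorem exists_prime_iter_phi_critPt (hp : p.Prime) (hp3 : 3 ≤ p) (hk : 0 < k)
    (hpk : ¬ (p : ℤ) ∣ k) {n : ℕ} (hn : 1 ≤ n)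
    (hsq : ∀ y : ℤ, (iter (phi p k) n).eval (critPt p k) ≠ k * y ^ 2) :
    ∃ (l r : ℕ) (u : ℤ), l.Prime ∧ ¬ (l : ℤ) ∣ k * p ∧ ¬ (l : ℤ) ∣ u ∧
      (iter (phi p k) n).eval (critPt p k) = l ^ (2 * r + 1) * u := by
  obtain ⟨m, rfl⟩ : ∃ m, n = m + 1 := ⟨n - 1, by omega⟩
  obtain ⟨c, hc, hcp, hck, hce⟩ := exists_iter_phi_eval_critPt k hp hp3 hk hpk m
  lift c to ℕ using hc.le
  obtain ⟨l, r, u, hl, hlu, rfl⟩ := exists_prime_odd_pow (c := c) (by exact_mod_cast hc) (by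
    rintro ⟨y, rfl⟩
    exact hsq y (by rw [hce]; push_cast; ring))
  have hl' : Prime (l : ℤ) := Nat.prime_iff_prime_int.1 hl
  have hlc : (l : ℤ) ∣ ((l ^ (2 * r + 1) * u : ℕ) : ℤ) := by
    exact_mod_cast Dvd.dvd.mul_right (dvd_pow_self l (by omega)) u
  -- `l` divides `c`, so `c ≡ 1` mod `p` excludes `l = p`; then `k ∣ c + p` excludes `l ∣ k`.
  have hlp : ¬ (l : ℤ) ∣ p := by
    intro h
    have h1 : (l : ℤ) ∣ 1 := by simpa using dvd_sub hlc (h.trans hcp)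
    exact hl'.not_dvd_one h1
  have hlk : ¬ (l : ℤ) ∣ k := by
    intro h
    exact hlp ((dvd_add_right hlc).1 (h.trans hck))
  refine ⟨l, r, k * u, hl, fun h => ?_, fun h => ?_, by rw [hce]; push_cast; ring⟩
  · exact (hl'.dvd_or_dvd h).elim hlk hlp
  · rcases hl'.dvd_or_dvd h with h | h
    · exact hlk h
    · exact hlu (by exact_mod_cast h)

/-- Eisenstein at `p`: the reduction is a power of `X` and the constant term `-kp` is not divisible
by `p^2`. -/
theorem irreducible_iter_phi (hp : p.Prime) (hp3 : 3 ≤ p) (hpk : ¬ (p : ℤ) ∣ k) (n : ℕ) :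
    Irreducible ((iter (phi p k) n).map (Int.castRingHom ℚ)) := by
  rcases n with - | n
  · simpa using irreducible_X
  have hdeg : (phi p k).natDegree ≠ 0 := by rw [natDegree_phi k hp3]; omega
  have hmon := monic_iter (monic_phi k hp3) hdeg (n + 1)
  refine (hmon.irreducible_iff_irreducible_map_fraction_map (K := ℚ)).1 ?_
  have hpr : Prime (p : ℤ) := Nat.prime_iff_prime_int.1 hp
  have hP : (Ideal.span {(p : ℤ)}).IsPrime := (Ideal.span_singleton_prime hpr.ne_zero).2 hpr
  have hmap : (iter (phi p k) (n + 1)).map (Int.castRingHom (ZMod p)) = X ^ p ^ (n + 1) := by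
    rw [iter_map, ← iter_X_pow]
    congr 1
    simp [phi, Polynomial.map_sub, Polynomial.map_add]
  have hnd : (iter (phi p k) (n + 1)).natDegree = p ^ (n + 1) := by
    rw [natDegree_iter, natDegree_phi k hp3]
  refine irreducible_of_eisenstein_criterion hP ?_ ?_ ?_ ?_ hmon.isPrimitive
  · rw [hmon.leadingCoeff]
    exact fun h => hP.ne_top ((Ideal.eq_top_iff_one _).2 h)
  · intro m hm
    rw [Ideal.mem_span_singleton, ← ZMod.intCast_zmod_eq_zero_iff_dvd,
      ← eq_intCast (Int.castRingHom (ZMod p)),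
      ← coeff_map, hmap, coeff_X_pow, if_neg]
    rintro rfl
    rw [degree_eq_natDegree hmon.ne_zero, hnd] at hm
    exact lt_irrefl _ hm
  · rw [← natDegree_pos_iff_degree_pos, hnd]
    exact pow_pos hp.pos _
  · rw [Ideal.span_singleton_pow, Ideal.mem_span_singleton, coeff_zero_eq_eval_zero,
      iter_phi_eval_zero k hp hp3, dvd_neg, pow_two]
    exact fun h => hpk ((mul_dvd_mul_iff_right hpr.ne_zero).1 h)

end Phi

/-! ### Multiple roots of iterates over a field. -/

section DoubleRoot

variable {F : Type*} [Field F] {φ : F[X]} {a b : F} {n : ℕ}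

/-- By the chain rule, some `φ^j(x)` with `j < m` is a critical point. If it is `0`, then `φ^m(x) =
b ≠ 0`. If it is `a`, then `φ^(m-j)(a) = 0`, and `φ^n(a) = 0` would again become `b` unless `m - j =
n`. -/
theorem eq_critical_of_double_root_iter (hcrit : ∀ x, (derivative φ).eval x = 0 → x = 0 ∨ x = a)
    (hb : b ≠ 0) (h0 : ∀ m, (iter φ (m + 1)).eval 0 = b) (hn : (iter φ n).eval a = 0) {m : ℕ}
    (hm : m ≤ n) {x : F} (hx : (iter φ m).eval x = 0) (hx' : (derivative (iter φ m)).eval x = 0) :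
    m = n ∧ x = a := by
  rw [derivative_iter_eval, Finset.prod_eq_zero_iff] at hx'
  obtain ⟨j, hj, hx'⟩ := hx'
  rw [Finset.mem_range] at hj
  obtain ⟨i, rfl⟩ : ∃ i, m = i + 1 + j := ⟨m - j - 1, by omega⟩
  rw [iter_eval_add] at hx
  rcases hcrit _ hx' with h | h
  · rw [h, h0] at hx
    exact absurd hx hb
  · rw [h] at hx
    obtain ⟨t, rfl⟩ : ∃ t, n = t + (i + 1) := ⟨n - (i + 1), by omega⟩
    rw [iter_eval_add, hx] at hn
    rcases t with - | t
    · obtain rfl : j = 0 := by omega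
      exact ⟨by omega, by simpa using h⟩
    · rw [h0] at hn
      exact absurd hn hb

/-- As `φ'(a) = 0`, the value is `φ''(a)` times `(φ^(n-1))'(φ(a))`. Vanishing of the latter would
make `φ(a)` a multiple root of `φ^(n-1)`, impossible before level `n`. -/
theorem derivative_derivative_iter_ne_zero
    (hcrit : ∀ x, (derivative φ).eval x = 0 → x = 0 ∨ x = a) (ha : (derivative φ).eval a = 0)
    (ha2 : (derivative (derivative φ)).eval a ≠ 0)
    (hb : b ≠ 0) (h0 : ∀ m, (iter φ (m + 1)).eval 0 = b) (hn1 : 1 ≤ n)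
    (hn : (iter φ n).eval a = 0) : (derivative (derivative (iter φ n))).eval a ≠ 0 := by
  obtain ⟨m, rfl⟩ : ∃ m, n = m + 1 := ⟨n - 1, by omega⟩
  rw [iter_succ_comp, derivative_comp, derivative_mul, eval_add, eval_mul, eval_mul, ha, zero_mul,
    add_zero, eval_comp]
  refine mul_ne_zero ha2 fun h => ?_
  have := (eq_critical_of_double_root_iter hcrit hb h0 hn (Nat.le_succ m)
    (x := φ.eval a) (by rw [← eval_comp, ← iter_succ_comp, hn]) h).1
  omega

end DoubleRoot

/-! ### Reduction of the iterates modulo `l`. -/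

section Phi

variable {p : ℕ} {k : ℤ}

theorem derivative_iter_phi_critPt (hp3 : 3 ≤ p) {n : ℕ} (hn : 1 ≤ n) :
    (derivative (iter (phi p k) n)).eval (critPt p k) = 0 := by
  obtain ⟨m, rfl⟩ : ∃ m, n = m + 1 := ⟨n - 1, by omega⟩
  rw [iter_succ_comp, derivative_comp, eval_mul, derivative_phi k hp3]
  simp

theorem phi_map_derivative_eq_zero {F : Type*} [Field F] (hp3 : 3 ≤ p)
    (hkp : ((k * p : ℤ) : F) ≠ 0) {x : F}
    (hx : (derivative ((phi p k).map (Int.castRingHom F))).eval x = 0) :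
    x = 0 ∨ x = (critPt p k : F) := by
  have hp0 : (p : F) ≠ 0 := by
    push_cast at hkp; exact right_ne_zero_of_mul hkp
  rw [derivative_map, derivative_phi k hp3] at hx
  simp only [Polynomial.map_mul, Polynomial.map_pow, Polynomial.map_sub, map_X, map_C, eval_mul,
    eval_pow, eval_sub, eval_X, eval_C, mul_eq_zero, Int.coe_castRingHom, Int.cast_natCast] at hx
  rcases hx with (hx | hx) | hx
  · exact absurd hx hp0
  · exact Or.inl (pow_eq_zero_iff (by omega) |>.1 hx)
  · exact Or.inr (sub_eq_zero.1 hx)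

theorem iter_map_eval_intCast {F : Type*} [Field F] (φ : ℤ[X]) (n : ℕ) (x : ℤ) :
    (iter (φ.map (Int.castRingHom F)) n).eval (x : F) = (((iter φ n).eval x : ℤ) : F) := by
  rw [← iter_map, eval_intCast_map]; rfl

theorem eq_critPt_of_double_root {F : Type*} [Field F] (hp : p.Prime) (hp3 : 3 ≤ p)
    (hkp : ((k * p : ℤ) : F) ≠ 0) {n : ℕ}
    (hn : (((iter (phi p k) n).eval (critPt p k) : ℤ) : F) = 0) {x : F}
    (hx : (iter (phi p k) n).eval₂ (Int.castRingHom F) x = 0)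
    (hx' : (derivative (iter (phi p k) n)).eval₂ (Int.castRingHom F) x = 0) :
    x = (critPt p k : F) := by
  rw [← eval_map, iter_map] at hx
  rw [← eval_map, ← derivative_map, iter_map] at hx'
  rw [← iter_map_eval_intCast] at hn
  exact (eq_critical_of_double_root_iter (b := ((-(k * p) : ℤ) : F))
    (fun x => phi_map_derivative_eq_zero hp3 hkp) (by simpa using hkp)
    (fun m => by rw [← iter_phi_eval_zero k hp hp3 m, ← iter_map_eval_intCast, Int.cast_zero])
    hn le_rfl hx hx').2

theorem not_dvd_derivative_derivative_iter_phi (hp : p.Prime) (hp3 : 3 ≤ p) {l : ℕ}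
    (hl : l.Prime) (hkp : ¬ (l : ℤ) ∣ k * p) {n : ℕ} (hn1 : 1 ≤ n)
    (hn : (l : ℤ) ∣ (iter (phi p k) n).eval (critPt p k)) :
    ¬ (l : ℤ) ∣ (derivative (derivative (iter (phi p k) n))).eval (critPt p k) := by
  have : Fact l.Prime := ⟨hl⟩
  rw [← ZMod.intCast_zmod_eq_zero_iff_dvd] at hkp hn ⊢
  have h0 : ∀ m, (iter ((phi p k).map (Int.castRingHom (ZMod l))) (m + 1)).eval 0 =
      ((-(k * p) : ℤ) : ZMod l) := fun m => by
    rw [← iter_phi_eval_zero k hp hp3 m, ← iter_map_eval_intCast, Int.cast_zero]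
  have hb : ((-(k * p) : ℤ) : ZMod l) ≠ 0 := by simpa using hkp
  rw [← iter_map_eval_intCast] at hn
  -- Otherwise the critical value would be `φ^n(0) = -kp`, nonzero mod `l`. This is needed because
  -- `φ''(a) = p a^(p-2)`; it also excludes `l = 2`, as `a` is even.
  have ha0 : (critPt p k : ZMod l) ≠ 0 := by
    intro h
    obtain ⟨m, rfl⟩ : ∃ m, n = m + 1 := ⟨n - 1, by omega⟩
    rw [h, h0] at hn
    exact hb hn
  have hp0 : (p : ZMod l) ≠ 0 := by
    push_cast at hkp; exact right_ne_zero_of_mul hkp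
  have := derivative_derivative_iter_ne_zero
    (φ := (phi p k).map (Int.castRingHom (ZMod l)))
    (fun x => phi_map_derivative_eq_zero hp3 hkp) (by
      rw [derivative_map, derivative_phi k hp3]; simp) (by
      rw [derivative_map, derivative_map, derivative_phi k hp3]
      simp [derivative_mul, hp0, ha0]) hb h0 hn1 hn
  rwa [← iter_map, derivative_map, derivative_map, eval_intCast_map] at this

end Phi

/-! ### A transposition from inertia. -/

open IsDedekindDomain WithZero NumberField

/-- If the sum of two elements of valuation less than one is at most their product in valuation,
then their valuations agree. -/
theorem valuation_eq_of_valuation_add_le {R : Type*} [CommRing R]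
    (v : Valuation R ℤᵐ⁰) {x y : R} (hx : v x ≠ 0) (hy : v y ≠ 0) (hx1 : v x < 1) (hy1 : v y < 1)
    (h : v (x + y) ≤ v x * v y) : v x = v y := by
  by_contra hne
  rw [Valuation.map_add_of_distinct_val _ hne] at h
  rcases lt_or_gt_of_ne hne with h1 | h1
  · rw [max_eq_right h1.le] at h
    exact absurd h (not_le.2 (by simpa using (mul_lt_mul_iff_left₀ (zero_lt_iff.2 hy)).2 hx1))
  · rw [max_eq_left h1.le] at h
    exact absurd h (not_le.2 (by simpa using (mul_lt_mul_iff_right₀ (zero_lt_iff.2 hx)).2 hy1))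

theorem exists_multiset_prod_ringOfIntegers {L : Type*} [Field L] [NumberField L] {f : ℤ[X]}
    (hf : f.Monic) (hs : (f.map (algebraMap ℤ L)).Splits) :
    ∃ M : Multiset (𝓞 L), f.map (algebraMap ℤ (𝓞 L)) = (M.map fun m => X - C m).prod := by
  have hint : ∀ x ∈ (f.map (algebraMap ℤ L)).roots, IsIntegral ℤ x := by
    intro x hx
    refine ⟨f, hf, ?_⟩
    have := (mem_roots'.1 hx).2
    rwa [IsRoot.def, eval_map] at this
  have : ∃ M : Multiset (𝓞 L), M.map (algebraMap (𝓞 L) L) = (f.map (algebraMap ℤ L)).roots := by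
    generalize (f.map (algebraMap ℤ L)).roots = N at hint
    induction N using Multiset.induction_on with
    | empty => exact ⟨0, rfl⟩
    | cons a N ih =>
      obtain ⟨M, rfl⟩ := ih fun x hx => hint x (Multiset.mem_cons_of_mem hx)
      obtain ⟨b, rfl⟩ : ∃ b : 𝓞 L, algebraMap (𝓞 L) L b = a :=
        IsIntegralClosure.isIntegral_iff.1 (hint a (Multiset.mem_cons_self _ _))
      exact ⟨b ::ₘ M, Multiset.map_cons _ _ _⟩
  obtain ⟨M, hM⟩ := this
  refine ⟨M, map_injective _ (FaithfulSMul.algebraMap_injective (𝓞 L) L) ?_⟩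
  rw [Polynomial.map_map, ← IsScalarTower.algebraMap_eq,
    hs.eq_prod_roots_of_monic (hf.map _), ← hM, Polynomial.map_multiset_prod]
  simp [Multiset.map_map]

/-- Let `f` have a critical point `a` whose critical value has odd valuation at a prime `l`, and
suppose that `f` modulo `l` has no multiple root but `a`, which is a double root. Then the inertia
group at `l` contains an automorphism that acts on the roots of `f` as a transposition. -/
theorem exists_algEquiv_swap_roots {L : Type} [Field L] [NumberField L] [IsGalois ℚ L] {f : ℤ[X]}
    (hf : f.Monic) (hsplit : (f.map (algebraMap ℤ L)).Splits)
    (hsep : (f.map (algebraMap ℤ L)).Separable)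
    (hfaith : ∀ σ : Gal(L/ℚ), (∀ x : L, aeval x f = 0 → σ x = x) → σ = 1)
    {l : ℕ} (hl : l.Prime) {a : ℤ} (ha : (derivative f).eval a = 0) {r : ℕ} {u : ℤ}
    (hu : ¬ (l : ℤ) ∣ u) (hval : f.eval a = l ^ (2 * r + 1) * u)
    (hcrit : ∀ (F : Type) [Field F] [CharP F l] (x : F),
      f.eval₂ (Int.castRingHom F) x = 0 → (derivative f).eval₂ (Int.castRingHom F) x = 0 → x = a)
    (ha2 : ¬ (l : ℤ) ∣ (derivative (derivative f)).eval a) :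
    ∃ (σ : Gal(L/ℚ)) (x y : L), x ≠ y ∧ aeval x f = 0 ∧ aeval y f = 0 ∧ σ x = y ∧ σ y = x ∧
      ∀ z, aeval z f = 0 → z ≠ x → z ≠ y → σ z = z := by
  classical
  have hl' : Prime (l : ℤ) := Nat.prime_iff_prime_int.1 hl
  have hP0 : (Ideal.span {(l : ℤ)}).IsPrime := (Ideal.span_singleton_prime hl'.ne_zero).2 hl'
  have hM0 : (Ideal.span {(l : ℤ)}).IsMaximal := by
    refine hP0.isMaximal ?_
    simpa using hl'.ne_zero
  obtain ⟨P, hPmax, hPl⟩ : ∃ P : Ideal (𝓞 L), P.IsMaximal ∧ P.LiesOver (Ideal.span {(l : ℤ)}) :=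
    Ideal.exists_maximal_ideal_liesOver_of_isIntegral _
  have hPZ : ∀ m : ℤ, (m : 𝓞 L) ∈ P ↔ (l : ℤ) ∣ m := by
    intro m
    have h := hPl.over
    rw [← Ideal.mem_span_singleton, h, Ideal.under_def, Ideal.mem_comap]
    simp
  obtain ⟨M, hM⟩ := exists_multiset_prod_ringOfIntegers hf hsplit
  have hML : f.map (algebraMap ℤ L) =
      ((M.map (algebraMap (𝓞 L) L)).map fun m => X - C m).prod := by
    rw [IsScalarTower.algebraMap_eq ℤ (𝓞 L) L, ← Polynomial.map_map, hM,
      Polynomial.map_multiset_prod]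
    simp [Multiset.map_map]
  have hroot : ∀ z : L, aeval z f = 0 ↔ ∃ m ∈ M, (m : L) = z := by
    intro z
    rw [aeval_def, ← eval_map, ← IsRoot.def, ← mem_roots (hf.map _).ne_zero, hML,
      roots_multiset_prod_X_sub_C, Multiset.mem_map]
  have hnodup : M.Nodup := by
    have := nodup_roots hsep
    rw [hML, roots_multiset_prod_X_sub_C] at this
    exact this.of_map
  have heval : ∀ g : ℤ[X], (g.map (algebraMap ℤ (𝓞 L))).eval (a : 𝓞 L) = (g.eval a : ℤ) := by
    intro g
    rw [← eq_intCast (algebraMap ℤ (𝓞 L)) a, eval_map_apply, eq_intCast]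
  have hfa : (f.map (algebraMap ℤ (𝓞 L))).eval (a : 𝓞 L) ∈ P := by
    rw [heval, hPZ, hval]
    exact Dvd.dvd.mul_right (dvd_pow_self _ (by omega)) _
  have hmemP : ∀ N : Multiset (𝓞 L), ∀ b : 𝓞 L, ((N.map fun m => X - C m).prod).eval b ∈ P →
      ∃ m ∈ N, b - m ∈ P := by
    intro N b h
    rw [eval_multiset_prod, hPmax.isPrime.multiset_prod_mem_iff_exists_mem] at h
    simpa [Multiset.map_map] using h
  obtain ⟨x, hx, hxP⟩ := hmemP M a (hM ▸ hfa)
  obtain ⟨M₁, rfl⟩ := Multiset.exists_cons_of_mem hx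
  rw [Multiset.map_cons, Multiset.prod_cons] at hM
  have hd1 := congr_arg (fun g => (derivative g).eval (a : 𝓞 L)) hM
  simp only [derivative_map, heval, ha, derivative_mul, eval_add, eval_mul, derivative_sub,
    derivative_X, derivative_C, sub_zero, one_mul, eval_sub, eval_X, eval_C,
    Int.cast_zero] at hd1
  -- Since `f'(a) = 0` and `a - x ∈ P`, the cofactor of `X - x` also vanishes at `a` mod `P`; this
  -- gives a second root reducing to `a`.
  obtain ⟨y, hy, hyP⟩ := hmemP M₁ a (by
    have h : eval (a : 𝓞 L) (M₁.map fun m => X - C m).prod =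
      -((a - x) * eval (a : 𝓞 L) (derivative (M₁.map fun m => X - C m).prod)) := by
        linear_combination -hd1
    rw [h]
    exact P.neg_mem (P.mul_mem_right _ hxP))
  obtain ⟨M₂, rfl⟩ := Multiset.exists_cons_of_mem hy
  rw [Multiset.map_cons, Multiset.prod_cons] at hM
  clear hd1
  set h := (M₂.map fun m => X - C m).prod with hh
  have hxy : x ≠ y := by
    rintro rfl
    simp at hnodup
  have hd0 := congr_arg (fun g => g.eval (a : 𝓞 L)) hM
  have hd1 := congr_arg (fun g => (derivative g).eval (a : 𝓞 L)) hM
  have hd2 := congr_arg (fun g => (derivative (derivative g)).eval (a : 𝓞 L)) hM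
  simp only [derivative_map, heval, ha, derivative_mul, eval_add, eval_mul, derivative_sub,
    derivative_X, derivative_C, sub_zero, one_mul, eval_sub, eval_X, eval_C,
    Int.cast_zero, derivative_add] at hd0 hd1 hd2
  -- Modulo `P`, `f''(a) ≡ 2 h(a)`, so no third root reduces to `a`.
  have hhP : h.eval (a : 𝓞 L) ∉ P := by
    intro hin
    refine ha2 ((hPZ _).1 ?_)
    have h3 : (((derivative (derivative f)).eval a : ℤ) : 𝓞 L) = 2 * h.eval (a : 𝓞 L) +
        (a - x) * (2 * (derivative h).eval (a : 𝓞 L) +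
          (a - y) * (derivative (derivative h)).eval (a : 𝓞 L)) +
        (a - y) * (2 * (derivative h).eval (a : 𝓞 L)) := by
      rw [hd2]; ring
    rw [h3]
    exact P.add_mem (P.add_mem (P.mul_mem_left _ hin) (P.mul_mem_right _ hxP))
      (P.mul_mem_right _ hyP)
  have hM₂P : ∀ m ∈ M₂, (a : 𝓞 L) - m ∉ P := by
    intro m hm hin
    obtain ⟨M₃, rfl⟩ := Multiset.exists_cons_of_mem hm
    apply hhP
    rw [hh, Multiset.map_cons, Multiset.prod_cons, eval_mul]
    exact P.mul_mem_right _ (by simpa using hin)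
  -- Two distinct roots congruent mod `P` give a multiple root of the reduction, which `hcrit`
  -- identifies with `a`.
  have hdouble : ∀ m ∈ x ::ₘ y ::ₘ M₂, ∀ m' ∈ x ::ₘ y ::ₘ M₂, m' ≠ m → m' - m ∈ P →
      (a : 𝓞 L) - m ∈ P := by
    intro m hm m' hm' hne hmm
    obtain ⟨N, hN⟩ := Multiset.exists_cons_of_mem hm
    have hm'N : m' ∈ N := by
      rw [hN, Multiset.mem_cons] at hm'
      exact hm'.resolve_left hne
    obtain ⟨N', rfl⟩ := Multiset.exists_cons_of_mem hm'N
    have hMN : f.map (algebraMap ℤ (𝓞 L)) =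
        (X - C m) * ((X - C m') * (N'.map fun m => X - C m).prod) := by
      have := congr_arg (fun M => (M.map fun m => X - C m).prod) hN
      simp only [Multiset.map_cons, Multiset.prod_cons] at this
      rw [hM, hh, this]
    let := Ideal.Quotient.field P
    have hchar : CharP (𝓞 L ⧸ P) l := by
      obtain ⟨q, hq⟩ := CharP.exists (𝓞 L ⧸ P)
      have h0 : ((l : ℕ) : 𝓞 L ⧸ P) = 0 := by
        rw [← map_natCast (Ideal.Quotient.mk P), Ideal.Quotient.eq_zero_iff_mem]
        exact_mod_cast (hPZ l).2 dvd_rfl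
      have h1 := (CharP.cast_eq_zero_iff (𝓞 L ⧸ P) q l).1 h0
      rcases (Nat.dvd_prime hl).1 h1 with rfl | rfl
      · exact absurd rfl (CharP.char_ne_one (𝓞 L ⧸ P) 1)
      · exact hq
    have hmk : ∀ g : ℤ[X], g.eval₂ (Int.castRingHom (𝓞 L ⧸ P)) (Ideal.Quotient.mk P m) =
        Ideal.Quotient.mk P ((g.map (algebraMap ℤ (𝓞 L))).eval m) := by
      intro g
      rw [eval_map, hom_eval₂]
      congr 1
    have := hcrit (𝓞 L ⧸ P) (Ideal.Quotient.mk P m) (by rw [hmk, hMN]; simp) (by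
      rw [hmk, ← derivative_map, hMN, Ideal.Quotient.eq_zero_iff_mem]
      simp only [derivative_mul, derivative_sub, derivative_X, derivative_C, eval_add, eval_mul,
        eval_sub, eval_X, eval_C, sub_self, zero_mul, sub_zero, one_mul, add_zero]
      rw [← neg_sub, neg_mul, neg_mem_iff]
      exact P.mul_mem_right _ hmm)
    rw [← Ideal.Quotient.eq_zero_iff_mem, map_sub, this, map_intCast, sub_self]
  have hdouble' : ∀ m ∈ x ::ₘ y ::ₘ M₂, (a : 𝓞 L) - m ∈ P → m = x ∨ m = y := by
    intro m hm hmP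
    rcases Multiset.mem_cons.1 hm with hm | hm
    · exact Or.inl hm
    rcases Multiset.mem_cons.1 hm with hm | hm
    · exact Or.inr hm
    · exact absurd hmP (hM₂P m hm)
  have hfa0 : ((f.eval a : ℤ) : 𝓞 L) ≠ 0 := by
    rw [Int.cast_ne_zero, hval]
    refine mul_ne_zero (pow_ne_zero _ hl'.ne_zero) ?_
    rintro rfl
    exact hu (dvd_zero _)
  have hax0 : (a : 𝓞 L) - x ≠ 0 := fun h0 => hfa0 (by rw [hd0, h0, zero_mul])
  have hay0 : (a : 𝓞 L) - y ≠ 0 := fun h0 => hfa0 (by rw [hd0, h0, zero_mul, mul_zero])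
  -- With trivial inertia, `P` is unramified and `f(a)` has valuation `2r + 1` there. But `f'(a) =
  -- 0` reads `((a-x) + (a-y)) h(a) = -(a-x)(a-y) h'(a)`, which forces `a - x` and `a - y` to have
  -- equal valuation, so that of `f(a)` is even.
  have hinertia : ∃ σ ∈ P.inertia Gal(L/ℚ), σ ≠ 1 := by
    by_contra! hcon
    have hI : P.inertia Gal(L/ℚ) = ⊥ := (Subgroup.eq_bot_iff_forall _).2 hcon
    have hcard := Ideal.card_inertia_eq_ramificationIdxIn (G := Gal(L/ℚ))
      (Ideal.span {(l : ℤ)}) P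
    rw [hI, Subgroup.card_bot,
      Ideal.ramificationIdxIn_eq_ramificationIdx (Ideal.span {(l : ℤ)}) P Gal(L/ℚ)] at hcard
    have hspan0 : (Ideal.span {(l : ℤ)}) ≠ ⊥ := by simpa using hl'.ne_zero
    have hPbot : P ≠ ⊥ := by
      rintro rfl
      have : ((l : ℤ) : 𝓞 L) ∈ (⊥ : Ideal (𝓞 L)) := (hPZ l).2 dvd_rfl
      simp [hl.ne_zero] at this
    let v : HeightOneSpectrum ℤ := ⟨Ideal.span {(l : ℤ)}, hP0, hspan0⟩
    let w : HeightOneSpectrum (𝓞 L) := ⟨P, hPmax.isPrime, hPbot⟩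
    have hvw : w.asIdeal.LiesOver v.asIdeal := hPl
    have he : v.asIdeal.ramificationIdx' w.asIdeal = 1 := by
      rw [hcard]
      exact Ideal.ramificationIdx'_eq_ramificationIdx _ _ hspan0
    have hvl : v.intValuation (l : ℤ) = exp (-1 : ℤ) :=
      v.intValuation_singleton hl'.ne_zero rfl
    have hvu : v.intValuation u = 1 := by
      rw [v.intValuation_eq_one_iff_mem_primeCompl]
      exact fun hmem => hu (Ideal.mem_span_singleton.1 hmem)
    have hwfa : w.intValuation ((f.eval a : ℤ) : 𝓞 L) = exp (-(2 * r + 1) : ℤ) := by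
      rw [← eq_intCast (algebraMap ℤ (𝓞 L)), ← HeightOneSpectrum.intValuation_liesOver v w, he,
        pow_one, hval, map_mul, map_pow, hvl, hvu, mul_one, ← exp_nsmul]
      congr 1
      simp
    have hwx0 := w.intValuation_ne_zero _ hax0
    have hwy0 := w.intValuation_ne_zero _ hay0
    have hwx1 := (w.intValuation_lt_one_iff_mem _).2 hxP
    have hwy1 := (w.intValuation_lt_one_iff_mem _).2 hyP
    have hwh : w.intValuation (h.eval (a : 𝓞 L)) = 1 :=
      (w.intValuation_eq_one_iff_mem_primeCompl _).2 hhP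
    have hwxy := valuation_eq_of_valuation_add_le w.intValuation hwx0 hwy0 hwx1 hwy1 (by
      rw [← mul_one (w.intValuation _), ← hwh, ← map_mul,
        show ((a : 𝓞 L) - x + (a - y)) * h.eval (a : 𝓞 L) =
          -((a - x) * (a - y) * (derivative h).eval (a : 𝓞 L)) by linear_combination -hd1,
        Valuation.map_neg, map_mul, map_mul]
      exact mul_le_of_le_one_right' (w.intValuation_le_one _))
    rw [hd0, map_mul, map_mul, hwh, mul_one, hwxy] at hwfa
    have hlog := congr_arg log hwfa
    rw [log_exp, log_mul hwy0 hwy0] at hlog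
    omega
  obtain ⟨σ, hσP, hσ1⟩ := hinertia
  have hmem : ∀ m ∈ x ::ₘ y ::ₘ M₂, σ • m ∈ x ::ₘ y ::ₘ M₂ := by
    intro m hm
    obtain ⟨m', hm', hmm'⟩ := (hroot (σ (m : L))).1 (by
      have := aeval_algHom_apply (σ.toAlgHom.restrictScalars ℤ) (m : L) f
      rw [(hroot _).2 ⟨m, hm, rfl⟩, map_zero] at this
      exact this)
    have : σ • m = m' := RingOfIntegers.coe_injective hmm'.symm
    rwa [this]
  -- Inertia keeps residues mod `P`, so a root that moves shares its residue with another root; both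
  -- are then among `x`, `y`.
  have hmove : ∀ m ∈ x ::ₘ y ::ₘ M₂, σ • m ≠ m → (m = x ∨ m = y) ∧ (σ • m = x ∨ σ • m = y) := by
    intro m hm hne
    have hin := hσP m
    have hmP := hdouble m hm _ (hmem m hm) hne hin
    refine ⟨hdouble' m hm hmP, hdouble' _ (hmem m hm) ?_⟩
    have := P.sub_mem hmP hin
    rwa [sub_sub, add_sub_cancel] at this
  have hfix : ∀ m ∈ x ::ₘ y ::ₘ M₂, m ≠ x → m ≠ y → σ • m = m := by
    intro m hm h1 h2
    by_contra hne
    exact (hmove m hm hne).1.elim h1 h2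
  have hx' : x ∈ x ::ₘ y ::ₘ M₂ := by simp
  have hy' : y ∈ x ::ₘ y ::ₘ M₂ := by simp
  have hσxy : σ • x = y ∧ σ • y = x := by
    by_cases h1 : σ • x = x
    · exfalso
      have h2 : σ • y = y := by
        by_contra hne
        rcases (hmove y hy' hne).2 with h2 | h2
        · exact hxy (MulAction.injective σ (h1.trans h2.symm))
        · exact hne h2
      refine hσ1 (hfaith σ fun z hz => ?_)
      obtain ⟨m, hm, rfl⟩ := (hroot z).1 hz
      have : σ • m = m := by
        by_cases hmx : m = x
        · rw [hmx, h1]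
        by_cases hmy : m = y
        · rw [hmy, h2]
        exact hfix m hm hmx hmy
      exact congr_arg (algebraMap (𝓞 L) L) this
    · have h2 : σ • x = y := (hmove x hx' h1).2.resolve_left h1
      have h3 : σ • y ≠ y := fun h3 => hxy (MulAction.injective σ (h2.trans h3.symm))
      exact ⟨h2, (hmove y hy' h3).2.resolve_right h3⟩
  refine ⟨σ, x, y, fun h0 => hxy (RingOfIntegers.coe_injective h0), (hroot _).2 ⟨x, hx', rfl⟩,
    (hroot _).2 ⟨y, hy', rfl⟩, congr_arg (algebraMap (𝓞 L) L) hσxy.1,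
    congr_arg (algebraMap (𝓞 L) L) hσxy.2, fun z hz hzx hzy => ?_⟩
  obtain ⟨m, hm, rfl⟩ := (hroot z).1 hz
  exact congr_arg (algebraMap (𝓞 L) L)
    (hfix m hm (fun h0 => hzx (by rw [h0])) fun h0 => hzy (by rw [h0]))

/-! ### Transpositions in an imprimitive group. -/

/-- In a transitive group of permutations that preserves the fibres of `π`, all of the same prime
size, one transposition forces every transposition of two points of a fibre. -/
theorem swap_mem_of_fiber_card_prime {R A : Type*} [Fintype R] [DecidableEq R] [DecidableEq A]
    (H : Subgroup (Equiv.Perm R)) (htrans : ∀ x y : R, ∃ h ∈ H, h x = y)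
    (π : R → A) (hπ : ∀ h ∈ H, ∀ x y, π x = π y → π (h x) = π (h y))
    {p : ℕ} (hp : p.Prime) (hcard : ∀ x, (Finset.univ.filter (fun y => π y = π x)).card = p)
    {s t : R} (hst : s ≠ t) (hswap : Equiv.swap s t ∈ H) {x y : R} (hxy : π x = π y) :
    Equiv.swap x y ∈ H := by
  classical
  -- The classes of this relation are permuted by `H`, so transitivity makes them equal in size.
  let r : Setoid R :=
    { r := fun x y => Equiv.swap x y ∈ H
      iseqv :=
        { refl := fun x => by rw [Equiv.swap_self]; exact H.one_mem
          symm := fun {x y} h => by rwa [Equiv.swap_comm]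
          trans := fun {x y z} h₁ h₂ => SubmonoidClass.swap_mem_trans H h₁ h₂ } }
  let C : R → Finset R := fun x => Finset.univ.filter (fun y => Equiv.swap x y ∈ H)
  have hconj : ∀ h ∈ H, ∀ x y, Equiv.swap x y ∈ H → Equiv.swap (h x) (h y) ∈ H := by
    intro h hh x y hxy
    rw [Equiv.swap_apply_apply]
    exact H.mul_mem (H.mul_mem hh hxy) (H.inv_mem hh)
  have hCle : ∀ x y, (C x).card ≤ (C y).card := by
    intro x y
    obtain ⟨h, hh, rfl⟩ := htrans x y
    refine Finset.card_le_card_of_injOn h ?_ h.injective.injOn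
    intro z hz
    simp only [C, Finset.coe_filter, Finset.mem_univ, true_and, Set.mem_ofPred_eq] at hz ⊢
    exact hconj h hh x z hz
  have hCeq : ∀ x y, (C x).card = (C y).card := fun x y => le_antisymm (hCle x y) (hCle y x)
  -- A transposition across two fibres would move `x` out of its fibre while fixing another point
  -- `z` of that fibre.
  have hfib : ∀ x y, Equiv.swap x y ∈ H → π y = π x := by
    intro x y h
    by_contra hne
    have hxy : x ≠ y := fun e => hne (by rw [e])
    obtain ⟨z, hz, hzx⟩ : ∃ z ∈ Finset.univ.filter (fun y => π y = π x), z ≠ x := by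
      apply Finset.exists_mem_ne
      rw [hcard]; exact hp.one_lt
    have hz : π z = π x := by simpa using hz
    have hzy : z ≠ y := fun e => hne (by rw [← e, hz])
    have := hπ _ h z x hz
    rw [Equiv.swap_apply_of_ne_of_ne hzx hzy, Equiv.swap_apply_left] at this
    exact hne (by rw [← this, hz])
  set F := Finset.univ.filter (fun y => π y = π x) with hF
  -- A fibre is a disjoint union of classes of equal size. As `p` is prime and the class of `s` is
  -- not a singleton, each class is a whole fibre.
  have hdvd : (C x).card ∣ p := by
    rw [← hcard x, ← hF, Finset.card_eq_sum_card_image (Quotient.mk r) F]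
    refine Finset.dvd_sum fun b hb => ?_
    obtain ⟨z, hz, rfl⟩ := Finset.mem_image.1 hb
    have hz : π z = π x := by simpa [hF] using hz
    rw [hCeq x z]
    apply dvd_of_eq
    congr 1
    ext w
    simp only [C, hF, Finset.mem_filter, Finset.mem_univ, true_and]
    constructor
    · intro h
      exact ⟨(hfib z w h).trans hz, Quotient.sound (r.symm h)⟩
    · rintro ⟨-, h⟩
      exact r.symm (Quotient.exact h)
  have hne1 : (C x).card ≠ 1 := by
    rw [hCeq x s]
    intro h
    obtain ⟨w, hw⟩ := Finset.card_eq_one.1 h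
    have h1 : s ∈ C s := by
      simp only [C, Finset.mem_filter, Finset.mem_univ, true_and, Equiv.swap_self]
      exact H.one_mem
    have h2 : t ∈ C s := by simpa [C] using hswap
    rw [hw, Finset.mem_singleton] at h1 h2
    exact hst (h1.trans h2.symm)
  have hcp : (C x).card = p := ((Nat.dvd_prime hp).1 hdvd).resolve_left hne1
  have hCF : C x = F := by
    refine Finset.eq_of_subset_of_card_le (fun w hw => ?_) (by rw [hcp, hF, hcard])
    simp only [C, hF, Finset.mem_filter, Finset.mem_univ, true_and] at hw ⊢
    exact hfib x w hw
  have : y ∈ C x := by rw [hCF, hF]; simp [hxy]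
  simpa [C] using this

/-! ### From fibre transpositions to the full product of symmetric groups. -/

section Assembly

variable {K : Type*} [Field K] {φ : K[X]}

theorem aeval_iter_succ_comp {A : Type*} [CommRing A] [Algebra K A] (m : ℕ) (x : A) :
    aeval x (iter φ (m + 1)) = aeval (aeval x φ) (iter φ m) := by
  rw [iter_succ_comp, aeval_comp]

theorem mem_splitField {n : ℕ} (hn : iter φ n ≠ 0) {x : AlgebraicClosure K}
    (hx : aeval x (iter φ n) = 0) : x ∈ splitField φ n :=
  IntermediateField.subset_adjoin _ _ (mem_rootSet.2 ⟨hn, hx⟩)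

instance isSplittingField_splitField (φ : K[X]) (n : ℕ) :
    IsSplittingField K (splitField φ n) (iter φ n) :=
  IntermediateField.adjoin_rootSet_isSplittingField (IsAlgClosed.splits _)

instance normal_splitField (φ : K[X]) (n : ℕ) : Normal K (splitField φ n) :=
  Normal.of_isSplittingField (iter φ n)

/-- Each root of `φ^m` is `φ(x)` for some root `x` of `φ^(m+1)`. -/
theorem splitField_le_succ (hφ : φ.Monic) (hd : φ.natDegree ≠ 0) (m : ℕ) :
    splitField φ m ≤ splitField φ (m + 1) := by
  refine IntermediateField.adjoin_le_iff.2 fun y hy => ?_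
  have hy := (mem_rootSet.1 hy).2
  obtain ⟨x, rfl⟩ : ∃ x, aeval x φ = y := by
    have hq : (φ.map (algebraMap K (AlgebraicClosure K)) - C y).degree ≠ 0 := by
      rw [degree_sub_C (by rw [degree_map]; exact natDegree_pos_iff_degree_pos.1 (by omega)),
        degree_map, degree_eq_natDegree hφ.ne_zero]
      exact_mod_cast hd
    obtain ⟨x, hx⟩ := IsAlgClosed.exists_root _ hq
    refine ⟨x, ?_⟩
    rwa [IsRoot.def, eval_sub, eval_C, eval_map_algebraMap, sub_eq_zero] at hx
  have hx : x ∈ splitField φ (m + 1) :=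
    mem_splitField (monic_iter hφ hd _).ne_zero (by rw [aeval_iter_succ_comp, hy])
  have := (aeval (⟨x, hx⟩ : splitField φ (m + 1)) φ).2
  rwa [← IntermediateField.aeval_coe] at this

theorem card_rootSet_iter (n : ℕ) (hsep : (iter φ n).Separable) :
    Nat.card ((iter φ n).rootSet (AlgebraicClosure K)) = (iter φ n).natDegree := by
  rw [Nat.card_eq_fintype_card, card_rootSet_eq_natDegree hsep (IsAlgClosed.splits _)]

/-- `φ - y` divides `φ^(m+1)` over the algebraic closure, so it inherits separability. -/
theorem card_fiber (hd : φ.natDegree ≠ 0) {m : ℕ}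
    (hsep : (iter φ (m + 1)).Separable) {y : AlgebraicClosure K} (hy : aeval y (iter φ m) = 0) :
    Nat.card {x : AlgebraicClosure K // aeval x φ = y} = φ.natDegree := by
  set q := φ.map (algebraMap K (AlgebraicClosure K)) - C y with hq
  have hdeg : q.natDegree = φ.natDegree := by rw [hq, natDegree_sub_C, natDegree_map]
  have hq0 : q ≠ 0 := by
    intro h0
    rw [h0, natDegree_zero] at hdeg
    exact hd hdeg.symm
  have hqsep : q.Separable := by
    refine (hsep.map (f := algebraMap K (AlgebraicClosure K))).of_dvd ?_
    rw [iter_succ_comp, map_comp]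
    obtain ⟨g, hg⟩ := dvd_iff_isRoot.2 (show IsRoot ((iter φ m).map
      (algebraMap K (AlgebraicClosure K))) y by rw [IsRoot.def, eval_map_algebraMap, hy])
    rw [hg, mul_comp, sub_comp, X_comp, C_comp]
    exact dvd_mul_right _ _
  rw [← hdeg, ← card_rootSet_eq_natDegree (K := AlgebraicClosure K) hqsep (IsAlgClosed.splits _),
    ← Nat.card_eq_fintype_card]
  refine Nat.card_congr (Equiv.subtypeEquivRight fun x => ?_)
  rw [mem_rootSet_of_ne hq0, hq, map_sub, aeval_map_algebraMap, aeval_C,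
    Algebra.algebraMap_self_apply, sub_eq_zero]

/-- The action on fibres is faithful because the roots of `φ^(m+1)` generate the top field, and onto
because transpositions generate each symmetric factor. -/
theorem galIsMaximal_of_forall_swap (hφ : φ.Monic) (hd : φ.natDegree ≠ 0) {m : ℕ}
    (hsep : (iter φ (m + 1)).Separable) (hsep' : (iter φ m).Separable)
    (hswap : ∀ x y : AlgebraicClosure K, aeval x (iter φ (m + 1)) = 0 →
      aeval x φ = aeval y φ → ∃ τ : AlgebraicClosure K ≃ₐ[K] AlgebraicClosure K,
        τ x = y ∧ τ y = x ∧ ∀ z, aeval z (iter φ (m + 1)) = 0 → z ≠ x → z ≠ y → τ z = z) :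
    GalIsMaximal φ (m + 1) := by
  classical
  have h := splitField_le_succ hφ hd m
  have hne := (monic_iter hφ hd m).ne_zero
  have hne' := (monic_iter hφ hd (m + 1)).ne_zero
  let E := IntermediateField.extendScalars h
  let α : Fin (iter φ m).natDegree ≃ (iter φ m).rootSet (AlgebraicClosure K) :=
    (Finite.equivFinOfCardEq (card_rootSet_iter m hsep')).symm
  have hα : ∀ i, aeval (α i : AlgebraicClosure K) (iter φ m) = 0 :=
    fun i => (mem_rootSet.1 (α i).2).2
  have hroot : ∀ i x, aeval x φ = (α i : AlgebraicClosure K) → aeval x (iter φ (m + 1)) = 0 := by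
    intro i x hx
    rw [aeval_iter_succ_comp, hx, hα]
  have hfib : ∀ i, Nat.card {x : E // aeval (x : AlgebraicClosure K) φ = α i} = φ.natDegree := by
    intro i
    rw [← card_fiber hd hsep (hα i)]
    exact Nat.card_congr
      { toFun := fun x => ⟨x.1, x.2⟩
        invFun := fun x => ⟨⟨x.1, mem_splitField hne' (hroot i x.1 x.2)⟩, x.2⟩
        left_inv := fun _ => rfl
        right_inv := fun _ => rfl }
  have hfin : ∀ i, Finite {x : E // aeval (x : AlgebraicClosure K) φ = α i} := fun i =>
    Nat.finite_of_card_ne_zero (by rw [hfib i]; exact hd)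
  let β : (i : Fin (iter φ m).natDegree) → (Fin φ.natDegree ≃
      {x : E // aeval (x : AlgebraicClosure K) φ = (α i : AlgebraicClosure K)}) :=
    fun i => (Finite.equivFinOfCardEq (hfib i)).symm
  have hact : ∀ (σ : E ≃ₐ[splitField φ m] E) i (x : E),
      aeval (x : AlgebraicClosure K) φ = α i → aeval ((σ x : E) : AlgebraicClosure K) φ = α i := by
    intro σ i x hx
    have h1 : aeval x φ = algebraMap (splitField φ m) E ⟨α i, mem_splitField hne (hα i)⟩ := by
      apply Subtype.ext
      rw [← IntermediateField.aeval_coe, hx]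
      rfl
    have h2 := aeval_algHom_apply (σ.toAlgHom.restrictScalars K) x φ
    rw [h1] at h2
    have h3 : aeval (σ x) φ = algebraMap (splitField φ m) E ⟨α i, mem_splitField hne (hα i)⟩ :=
      h2.trans (σ.commutes _)
    rw [IntermediateField.aeval_coe, h3]
    rfl
  let act : (E ≃ₐ[splitField φ m] E) → (i : Fin (iter φ m).natDegree) →
      Equiv.Perm {x : E // aeval (x : AlgebraicClosure K) φ = (α i : AlgebraicClosure K)} :=
    fun σ i =>
      { toFun := fun x => ⟨σ x.1, hact σ i x.1 x.2⟩
        invFun := fun x => ⟨σ.symm x.1, hact σ.symm i x.1 x.2⟩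
        left_inv := fun x => Subtype.ext (σ.symm_apply_apply x.1)
        right_inv := fun x => Subtype.ext (σ.apply_symm_apply x.1) }
  let ψ : (E ≃ₐ[splitField φ m] E) →*
      (Fin (iter φ m).natDegree → Equiv.Perm (Fin φ.natDegree)) :=
    { toFun := fun σ i => (β i).symm.permCongr (act σ i)
      map_one' := by
        ext i j
        simp [act, Equiv.permCongr_apply]
      map_mul' := by
        intro σ τ
        ext i j
        simp [act, Equiv.permCongr_apply] }
  have hψ : ∀ σ i j, σ (β i j).1 = (β i (ψ σ i j)).1 := by
    intro σ i j
    simp [ψ, act, Equiv.permCongr_apply]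
  have hβ : ∀ z (hz : aeval z (iter φ (m + 1)) = 0),
      ∃ i j, (β i j).1 = ⟨z, mem_splitField hne' hz⟩ := by
    intro z hz
    obtain ⟨i, hi⟩ := α.surjective ⟨aeval z φ, mem_rootSet.2 ⟨hne, by
      rw [← aeval_iter_succ_comp, hz]⟩⟩
    obtain ⟨j, hj⟩ := (β i).surjective ⟨⟨z, mem_splitField hne' hz⟩, by rw [hi]⟩
    exact ⟨i, j, by rw [hj]⟩
  have hinj : Function.Injective ψ := by
    rw [injective_iff_map_eq_one]
    intro σ hσ
    have hfix : ∀ x (hx : x ∈ splitField φ (m + 1)), σ (⟨x, hx⟩ : E) = (⟨x, hx⟩ : E) := by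
      intro x hx
      refine IntermediateField.adjoin_induction K
        (p := fun x hx => σ (⟨x, hx⟩ : E) = (⟨x, hx⟩ : E)) ?_ ?_ ?_ ?_ ?_ hx
      · intro z hz
        obtain ⟨i, j, hij⟩ := hβ z (mem_rootSet.1 hz).2
        rw [← hij, hψ, hσ]
        rfl
      · intro c
        exact σ.commutes (algebraMap K (splitField φ m) c)
      · intro x y hx hy h1 h2
        have := map_add σ (⟨x, hx⟩ : E) ⟨y, hy⟩
        rw [h1, h2] at this
        exact this
      · intro x hx h1
        have := map_inv₀ σ (⟨x, hx⟩ : E)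
        rw [h1] at this
        exact this
      · intro x y hx hy h1 h2
        have := map_mul σ (⟨x, hx⟩ : E) ⟨y, hy⟩
        rw [h1, h2] at this
        exact this
    ext x
    rw [show σ x = x from hfix x.1 x.2]
    rfl
  have hnormal : Normal K E := inferInstanceAs (Normal K (splitField φ (m + 1)))
  have hnormal' : Normal (splitField φ m) E := Normal.tower_top_of_normal K _ _
  have hmulSingle : ∀ (i : Fin (iter φ m).natDegree) (j j' : Fin φ.natDegree),
      Pi.mulSingle i (Equiv.swap j j') ∈ ψ.range := by
    intro i j j'
    obtain ⟨τ, hτx, hτy, hτz⟩ := hswap (β i j).1 (β i j').1 (hroot i _ (β i j).2)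
      ((β i j).2.trans (β i j').2.symm)
    have hτfib : ∀ z, aeval z (iter φ (m + 1)) = 0 → aeval (τ z) φ = aeval z φ := by
      intro z hz
      by_cases h1 : z = (β i j).1
      · rw [h1, hτx, (β i j).2, (β i j').2]
      by_cases h2 : z = (β i j').1
      · rw [h2, hτy, (β i j).2, (β i j').2]
      rw [hτz z hz h1 h2]
    -- Each root of `φ^m` is `φ(z)` with `z` in its fibre, and `τ` preserves fibres; so `τ` fixes
    -- generators of the lower field and induces an element of the relative Galois group.
    have hτα : ∀ x, x ∈ splitField φ m → τ x = x := by
      have hle : splitField φ m ≤ IntermediateField.fixedField (Subgroup.zpowers τ) := by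
        refine IntermediateField.adjoin_le_iff.2 fun y hy => ?_
        obtain ⟨l, hl⟩ := α.surjective ⟨y, hy⟩
        obtain ⟨j₀⟩ : Nonempty (Fin φ.natDegree) := ⟨⟨0, Nat.pos_of_ne_zero hd⟩⟩
        have hz : aeval ((β l j₀).1 : AlgebraicClosure K) φ = y :=
          (β l j₀).2.trans (congr_arg Subtype.val hl)
        have : τ y = y := by
          have h1 := hτfib _ (hroot l _ (β l j₀).2)
          have h2 := aeval_algHom_apply τ.toAlgHom ((β l j₀).1 : AlgebraicClosure K) φ
          rw [hz] at h1 h2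
          exact h2.symm.trans h1
        rw [SetLike.mem_coe, IntermediateField.mem_fixedField_iff]
        intro g hg
        have hstab : Subgroup.zpowers τ ≤ MulAction.stabilizer
            (AlgebraicClosure K ≃ₐ[K] AlgebraicClosure K) y := by
          rw [Subgroup.zpowers_le]
          exact this
        exact hstab hg
      intro x hx
      exact (IntermediateField.mem_fixedField_iff _ _).1 (hle hx) τ (Subgroup.mem_zpowers τ)
    let τ' : AlgebraicClosure K ≃ₐ[splitField φ m] AlgebraicClosure K :=
      AlgEquiv.ofRingEquiv (f := τ.toRingEquiv) fun x => hτα x x.2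
    refine ⟨τ'.restrictNormal E, ?_⟩
    have hcomm : ∀ x : E, ((τ'.restrictNormal E x : E) : AlgebraicClosure K) = τ x :=
      fun x => AlgEquiv.restrictNormal_commutes τ' E x
    have hinjβ : ∀ l (b c : Fin φ.natDegree), ((β l b).1 : AlgebraicClosure K) = (β l c).1 →
        b = c := fun l b c hbc => (β l).injective (Subtype.ext (Subtype.ext hbc))
    funext l
    ext b : 1
    refine hinjβ l _ _ ?_
    rw [← hψ, hcomm]
    by_cases hl : l = i
    · subst hl
      rw [Pi.mulSingle_eq_same]
      by_cases h1 : b = j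
      · rw [h1, hτx, Equiv.swap_apply_left]
      by_cases h2 : b = j'
      · rw [h2, hτy, Equiv.swap_apply_right]
      rw [Equiv.swap_apply_of_ne_of_ne h1 h2]
      exact hτz _ (hroot l _ (β l b).2) (fun e => h1 (hinjβ l _ _ e)) fun e => h2 (hinjβ l _ _ e)
    · rw [Pi.mulSingle_eq_of_ne hl]
      have hne_fib : ∀ c, ((β l b).1 : AlgebraicClosure K) ≠ (β i c).1 := by
        intro c hc
        refine hl (α.injective (Subtype.ext ?_))
        rw [← (β l b).2, hc, (β i c).2]
      exact hτz _ (hroot l _ (β l b).2) (hne_fib j) (hne_fib j')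
  have hsurj : Function.Surjective ψ := by
    rw [← MonoidHom.range_eq_top, eq_top_iff]
    intro s _
    refine Subgroup.pi_mem_of_mulSingle_mem s fun i => ?_
    have hle : (⊤ : Subgroup (Equiv.Perm (Fin φ.natDegree))) ≤
        ψ.range.comap (MonoidHom.mulSingle (fun _ => Equiv.Perm (Fin φ.natDegree)) i) := by
      rw [← Equiv.Perm.closure_isSwap, Subgroup.closure_le]
      rintro _ ⟨j, j', -, rfl⟩
      exact hmulSingle i j j'
    exact hle (Subgroup.mem_top (s i))
  exact ⟨h, α, β, MulEquiv.ofBijective ψ ⟨hinj, hsurj⟩, hψ⟩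

end Assembly

/-! ### Transpositions in the Galois group of an iterate. -/

section Swaps

theorem exists_algEquiv_of_irreducible_iter {K : Type*} [Field K] {f : K[X]} (hf : Irreducible f)
    {x y : AlgebraicClosure K} (hx : aeval x f = 0) (hy : aeval y f = 0) :
    ∃ σ : AlgebraicClosure K ≃ₐ[K] AlgebraicClosure K, σ x = y := by
  refine IsConjRoot.exists_algEquiv ?_ |>.imp fun _ h => h
  rw [isConjRoot_def, ← minpoly.eq_of_irreducible hf hx, ← minpoly.eq_of_irreducible hf hy]

/-- One automorphism acting as a transposition on the roots of an irreducible iterate `φ^(m+1)`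
yields all transpositions within the fibres of `φ`, when `φ` has prime degree. -/
theorem forall_swap_of_exists_swap {K : Type*} [Field K] {φ : K[X]} (hp : φ.natDegree.Prime)
    {m : ℕ} (hirr : Irreducible (iter φ (m + 1))) (hsep : (iter φ (m + 1)).Separable)
    (hswap : ∃ (τ : AlgebraicClosure K ≃ₐ[K] AlgebraicClosure K) (x y : AlgebraicClosure K),
      x ≠ y ∧ aeval x (iter φ (m + 1)) = 0 ∧ aeval y (iter φ (m + 1)) = 0 ∧ τ x = y ∧ τ y = x ∧
        ∀ z, aeval z (iter φ (m + 1)) = 0 → z ≠ x → z ≠ y → τ z = z)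
    (x y : AlgebraicClosure K) (hx : aeval x (iter φ (m + 1)) = 0)
    (hxy : aeval x φ = aeval y φ) : ∃ τ : AlgebraicClosure K ≃ₐ[K] AlgebraicClosure K,
      τ x = y ∧ τ y = x ∧ ∀ z, aeval z (iter φ (m + 1)) = 0 → z ≠ x → z ≠ y → τ z = z := by
  classical
  let Ω := AlgebraicClosure K
  let R := (iter φ (m + 1)).rootSet Ω
  have hmem : ∀ z : Ω, z ∈ R ↔ aeval z (iter φ (m + 1)) = 0 := fun z =>
    mem_rootSet_of_ne hirr.ne_zero
  have hy : aeval y (iter φ (m + 1)) = 0 := by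
    rw [aeval_iter_succ_comp, ← hxy, ← aeval_iter_succ_comp, hx]
  -- The permutations of the roots of `φ^(m+1)` induced by Galois: transitive by irreducibility, and
  -- compatible with the fibres of `φ` since its coefficients lie in `K`.
  let H : Subgroup (Equiv.Perm R) := (MulAction.toPermHom (Ω ≃ₐ[K] Ω) R).range
  obtain ⟨τ, s, t, hst, hs, ht, hτs, hτt, hτ⟩ := hswap
  have key := swap_mem_of_fiber_card_prime H ?_ (fun z : R => aeval (z : Ω) φ) ?_ hp ?_
    (s := ⟨s, (hmem s).2 hs⟩) (t := ⟨t, (hmem t).2 ht⟩) (by simpa using hst) ?_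
    (x := ⟨x, (hmem x).2 hx⟩) (y := ⟨y, (hmem y).2 hy⟩) hxy
  · obtain ⟨τ, hτ⟩ := key
    have hτ' : ∀ z : R, τ z = (Equiv.swap (⟨x, (hmem x).2 hx⟩ : R) ⟨y, (hmem y).2 hy⟩ z : R) := by
      intro z
      rw [← hτ]
      rfl
    refine ⟨τ, ?_, ?_, fun z hz hzx hzy => ?_⟩
    · simpa using hτ' ⟨x, (hmem x).2 hx⟩
    · simpa using hτ' ⟨y, (hmem y).2 hy⟩
    · have := hτ' ⟨z, (hmem z).2 hz⟩
      rwa [Equiv.swap_apply_of_ne_of_ne (by simpa using hzx) (by simpa using hzy)] at this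
  · rintro ⟨a, ha⟩ ⟨b, hb⟩
    obtain ⟨σ, hσ⟩ := exists_algEquiv_of_irreducible_iter hirr ((hmem a).1 ha) ((hmem b).1 hb)
    exact ⟨_, ⟨σ, rfl⟩, Subtype.ext hσ⟩
  · rintro _ ⟨σ, rfl⟩ a b hab
    have h1 : ∀ c : R, aeval (σ (c : Ω)) φ = σ (aeval (c : Ω) φ) := fun c =>
      aeval_algHom_apply σ.toAlgHom (c : Ω) φ
    exact (h1 a).trans ((congr_arg σ hab).trans (h1 b).symm)
  · intro a
    have ha := (hmem _).1 a.2
    rw [aeval_iter_succ_comp] at ha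
    rw [← card_fiber hp.ne_zero hsep ha, ← Fintype.card_subtype, ← Nat.card_eq_fintype_card]
    exact Nat.card_congr
      { toFun := fun z => ⟨z.1, z.2⟩
        invFun := fun z => ⟨⟨z.1, (hmem _).2 (by rw [aeval_iter_succ_comp, z.2, ha])⟩, z.2⟩
        left_inv := fun _ => rfl
        right_inv := fun _ => rfl }
  · refine ⟨τ, Equiv.ext fun z => Subtype.ext ?_⟩
    change τ z = _
    by_cases h1 : (z : Ω) = s
    · rw [show z = ⟨s, (hmem s).2 hs⟩ from Subtype.ext h1, Equiv.swap_apply_left, hτs]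
    by_cases h2 : (z : Ω) = t
    · rw [show z = ⟨t, (hmem t).2 ht⟩ from Subtype.ext h2, Equiv.swap_apply_right, hτt]
    rw [Equiv.swap_apply_of_ne_of_ne (fun e => h1 (congr_arg Subtype.val e))
      fun e => h2 (congr_arg Subtype.val e)]
    exact hτ z ((hmem _).1 z.2) h1 h2

theorem exists_swap_splittingField_iter_phi {p : ℕ} (hp : p.Prime) (hp3 : 3 ≤ p) {k : ℤ}
    (hk : 0 < k) (hpk : ¬ (p : ℤ) ∣ k) {n : ℕ} (hn : 1 ≤ n)
    (hsq : ∀ y : ℤ, (iter (phi p k) n).eval (critPt p k) ≠ k * y ^ 2)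
    (L : Type) [Field L] [inst : Algebra ℚ L]
    [hsplit : IsSplittingField ℚ L (iter ((phi p k).map (Int.castRingHom ℚ)) n)] :
    ∃ (σ : L ≃ₐ[ℚ] L) (x y : L),
      x ≠ y ∧ aeval x (iter ((phi p k).map (Int.castRingHom ℚ)) n) = 0 ∧
        aeval y (iter ((phi p k).map (Int.castRingHom ℚ)) n) = 0 ∧ σ x = y ∧ σ y = x ∧
        ∀ z, aeval z (iter ((phi p k).map (Int.castRingHom ℚ)) n) = 0 → z ≠ x → z ≠ y →
          σ z = z := by
  have hchar : CharZero L := algebraRat.charZero L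
  -- A field has at most one `ℚ`-algebra structure; the given one is replaced by the canonical one
  -- used for number fields.
  obtain rfl : inst = DivisionRing.toRatAlgebra := Subsingleton.elim _ _
  set φ := (phi p k).map (Int.castRingHom ℚ) with hφ
  have hmap : iter φ n = (iter (phi p k) n).map (algebraMap ℤ ℚ) := (iter_map _ _ _).symm
  have hirr : Irreducible (iter φ n) := by
    rw [hmap]; exact irreducible_iter_phi k hp hp3 hpk n
  have : FiniteDimensional ℚ L := IsSplittingField.finiteDimensional L (iter φ n)
  have : NumberField L := ⟨⟩
  have : IsGalois ℚ L := IsGalois.of_separable_splitting_field hirr.separable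
  have hmapL : (iter (phi p k) n).map (algebraMap ℤ L) = (iter φ n).map (algebraMap ℚ L) := by
    rw [hmap, Polynomial.map_map, ← IsScalarTower.algebraMap_eq]
  have haeval : ∀ z : L, aeval z (iter φ n) = aeval z (iter (phi p k) n) := by
    intro z
    rw [hmap, aeval_map_algebraMap]
  obtain ⟨l, r, u, hl, hlkp, hlu, hval⟩ := exists_prime_iter_phi_critPt k hp hp3 hk hpk hn hsq
  have hdvd : (l : ℤ) ∣ (iter (phi p k) n).eval (critPt p k) := by
    rw [hval]
    exact Dvd.dvd.mul_right (dvd_pow_self _ (by omega)) _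
  have hdeg : (phi p k).natDegree ≠ 0 := by rw [natDegree_phi k hp3]; omega
  simp only [haeval]
  exact exists_algEquiv_swap_roots (L := L)
    (monic_iter (monic_phi k hp3) hdeg n) (by rw [hmapL]; exact hsplit.splits)
    (by rw [hmapL]; exact hirr.separable.map)
    (fun σ hσ => by
      have := AlgHom.ext_of_adjoin_eq_top (φ₁ := σ.toAlgHom) (φ₂ := AlgHom.id ℚ L)
        hsplit.adjoin_rootSet fun z hz => hσ z (by
          rw [← haeval]; exact (mem_rootSet.1 hz).2)
      ext z
      exact DFunLike.congr_fun this z)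
    hl (derivative_iter_phi_critPt hp3 hn) hlu hval
    (fun F _ _ x hx hx' => eq_critPt_of_double_root hp hp3
      (fun h => hlkp ((CharP.intCast_eq_zero_iff F l _).1 h))
      ((CharP.intCast_eq_zero_iff F l _).2 hdvd) hx hx')
    (not_dvd_derivative_derivative_iter_phi hp hp3 hl hlkp hn hdvd)

theorem exists_swap_of_exists_swap_splitField {K : Type*} [Field K] {φ : K[X]} {n : ℕ}
    (hn : iter φ n ≠ 0)
    (h : ∃ (σ : splitField φ n ≃ₐ[K] splitField φ n) (x y : splitField φ n),
      x ≠ y ∧ aeval x (iter φ n) = 0 ∧ aeval y (iter φ n) = 0 ∧ σ x = y ∧ σ y = x ∧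
        ∀ z, aeval z (iter φ n) = 0 → z ≠ x → z ≠ y → σ z = z) :
    ∃ (τ : AlgebraicClosure K ≃ₐ[K] AlgebraicClosure K) (x y : AlgebraicClosure K),
      x ≠ y ∧ aeval x (iter φ n) = 0 ∧ aeval y (iter φ n) = 0 ∧ τ x = y ∧ τ y = x ∧
        ∀ z, aeval z (iter φ n) = 0 → z ≠ x → z ≠ y → τ z = z := by
  obtain ⟨σ, x, y, hxy, hx, hy, hσx, hσy, hσ⟩ := h
  obtain ⟨τ, rfl⟩ := AlgEquiv.restrictNormalHom_surjective (AlgebraicClosure K) σ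
  have hτ : ∀ z : splitField φ n,
      ((AlgEquiv.restrictNormalHom (splitField φ n) τ z : splitField φ n) :
        AlgebraicClosure K) = τ z :=
    fun z => AlgEquiv.restrictNormal_commutes τ (splitField φ n) z
  have hroot : ∀ z : splitField φ n,
      aeval (z : AlgebraicClosure K) (iter φ n) = 0 ↔ aeval z (iter φ n) = 0 := by
    intro z
    rw [IntermediateField.aeval_coe, ZeroMemClass.coe_eq_zero]
  refine ⟨τ, x, y, fun h => hxy (Subtype.ext h), (hroot x).2 hx, (hroot y).2 hy, ?_, ?_,
    fun z hz hzx hzy => ?_⟩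
  · rw [← hτ, hσx]
  · rw [← hτ, hσy]
  · have hz' := mem_splitField hn hz
    have := hσ ⟨z, hz'⟩ ((hroot ⟨z, hz'⟩).1 hz) (fun e => hzx (congr_arg Subtype.val e))
      fun e => hzy (congr_arg Subtype.val e)
    exact (hτ ⟨z, hz'⟩).symm.trans (congr_arg Subtype.val this)

end Swaps

end Arboreal

theorem mainTheorem7 (p : ℕ) (hp : p.Prime) (hp3 : 3 ≤ p) (k : ℤ) (hk : 0 < k)
    (hpk : ¬ (p : ℤ) ∣ k) (n : ℕ) (hn : 1 ≤ n)
    (hsq : ∀ y : ℤ,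
      (Arboreal.iter (Arboreal.phi p k) n).eval (Arboreal.critPt p k) ≠ k * y ^ 2) :
    Arboreal.GalIsMaximal ((Arboreal.phi p k).map (Int.castRingHom ℚ)) n := by
  obtain ⟨m, rfl⟩ : ∃ m, n = m + 1 := ⟨n - 1, by omega⟩
  have hmonic := (Arboreal.monic_phi k hp3).map (Int.castRingHom ℚ)
  have hdeg : ((Arboreal.phi p k).map (Int.castRingHom ℚ)).natDegree = p := by
    rw [(Arboreal.monic_phi k hp3).natDegree_map, Arboreal.natDegree_phi k hp3]
  have hirr : ∀ j, Irreducible (Arboreal.iter ((Arboreal.phi p k).map (Int.castRingHom ℚ)) j) := by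
    intro j
    rw [← Arboreal.iter_map]
    exact Arboreal.irreducible_iter_phi k hp hp3 hpk j
  exact Arboreal.galIsMaximal_of_forall_swap hmonic (by rw [hdeg]; exact hp.ne_zero)
    (hirr _).separable (hirr _).separable
    (Arboreal.forall_swap_of_exists_swap (by rw [hdeg]; exact hp) (hirr _) (hirr _).separable
      (Arboreal.exists_swap_of_exists_swap_splitField (hirr _).ne_zero
        (Arboreal.exists_swap_splittingField_iter_phi hp hp3 hk hpk hn hsq _)))
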